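/- Let $G$ be a finite group. Let $V(\mathbb{Z}G)$ be the group of units of the integral group ring $\mathbb{Z}G$ of augmentation $1$, where the augmentation of $\sum_{x\in G} a_x x$ is $\sum_{x\in G} a_x$. For $g\in G$ let $g^G$ be the conjugacy class of $g$ in $G$, and for $a=\sum_{x\in G} a_x x\in\mathbb{Z}G$ let $\varepsilon_g(a)=\sum_{x\in g^G} a_x$ be the partial augmentation of $a$ at $g$. Let $u$ be an element of $V(\mathbb{Z}G)$ of finite order $n$. Then the following are equivalent: 1. $u$ is rationally conjugate to an element of $G$, i.e. there are $g\in G$ and a unit $w$ of $\mathbb{Q}G$ with $wuw^{-1}=g$. 2. For every positive divisor $d$ of $n$ there is $g_d\in G$ such that $\varepsilon_g(u^d)=0$ for every $g\in G\setminus g_d^G$. 3. $\varepsilon_g(u^d)\ge 0$ for every positive divisor $d$ of $n$ and every $g\in G$. -/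

import Mathlib

namespace IntegralGroupRing

/-- The augmentation map `R G → R`, `∑ r_g g ↦ ∑ r_g`: the `R`-linear extension of the trivial
homomorphism from `G` to the multiplicative monoid of `R`. -/
noncomputable def augmentation (R G : Type*) [CommRing R] [Group G] :
    MonoidAlgebra R G →ₐ[R] R :=
  MonoidAlgebra.lift R R G (1 : G →* R)

/-- The group `V(RG)` of normalized units: the units of `RG` of augmentation `1`. -/
noncomputable def normalizedUnits (R G : Type*) [CommRing R] [Group G] :
    Subgroup (MonoidAlgebra R G)ˣ :=
  (Units.map (augmentation R G : MonoidAlgebra R G →* R)).ker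

/-- For a subset `X` of `G`, `ε_X(a) = ∑_{x ∈ X} a_x`, where `a = ∑_g a_g g`. The sum is finite
since `a` has finite support. -/
noncomputable def partialSum {R G : Type*} [CommRing R] (X : Set G)
    (a : MonoidAlgebra R G) : R :=
  ∑ᶠ x ∈ X, a.coeff x

/-- The partial augmentation `ε_g(a)` of `a` at `g`: the sum of the coefficients of `a` over the
conjugacy class `g^G` of `g` in `G`. -/
noncomputable def partialAugmentation {R G : Type*} [CommRing R] [Group G] (g : G)
    (a : MonoidAlgebra R G) : R :=
  partialSum (conjugatesOf g) a

/-- The inclusion of `G` in the group of units of `RG`. -/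
noncomputable def groupUnit (R : Type*) {G : Type*} [CommRing R] [Group G] (g : G) :
    (MonoidAlgebra R G)ˣ :=
  Units.map (MonoidAlgebra.of R G) (toUnits g)

/-- The inclusion of the units of `ℤG` in the units of `ℚG`. -/
noncomputable def toRationalUnits (G : Type*) [Group G] :
    (MonoidAlgebra ℤ G)ˣ →* (MonoidAlgebra ℚ G)ˣ :=
  Units.map (MonoidAlgebra.mapRingHom G (Int.castRingHom ℚ) :
    MonoidAlgebra ℤ G →* MonoidAlgebra ℚ G)

/-- Two units of `ℤG` are rationally conjugate if they are conjugate within the group of units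
of `ℚG`. -/
def RationallyConjugate {G : Type*} [Group G] (u v : (MonoidAlgebra ℤ G)ˣ) : Prop :=
  ∃ w : (MonoidAlgebra ℚ G)ˣ, w * toRationalUnits G u * w⁻¹ = toRationalUnits G v

end IntegralGroupRing

/-! Partial augmentations are invariant under conjugation and vanish on additive commutators; this
gives 1 → 3. Nonnegative integers with sum 1 are all 0 but one, which gives 3 → 2. For 2 → 1, each
`u ^ d` with `d ∣ n` has the partial augmentations of a single `g_d`. The congruence
`partialAugmentation_pow_prime` forces `g_d` to be conjugate to `g ^ d`, where `g = g_1`.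
Dirichlet's theorem on primes extends the agreement to all powers
(`partialAugmentation_pow_eq_single`). Finally, `u` and `g` make `ℚG` into two modules over `K × G`,
with `K` cyclic acting on the left and `G` on the right. The characters depend only on partial
augmentations, so the modules are isomorphic, and the image of 1 conjugates `u` to `g`
(`isConj_of_partialAugmentation_pow_eq`). -/

namespace IntegralGroupRing

/-! ### Partial augmentations as trace functionals -/

section PartialAugmentation

variable {R G : Type*} [CommRing R] [Group G]

open scoped Classical in
lemma partialAugmentation_eq_sum [Fintype G] (g : G) (a : MonoidAlgebra R G) :
    partialAugmentation g a = ∑ x, if IsConj g x then a.coeff x else 0 := by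
  rw [partialAugmentation, partialSum, finsum_mem_def, finsum_eq_sum_of_fintype]
  simp [Set.indicator_apply, conjugatesOf]

lemma partialAugmentation_congr {g h : G} (H : IsConj g h) (a : MonoidAlgebra R G) :
    partialAugmentation g a = partialAugmentation h a := by
  rw [partialAugmentation, partialAugmentation, isConj_iff_conjugatesOf_eq.1 H]

/-- The partial augmentation as a linear functional. -/
noncomputable def partialAugmentationLinear (R : Type*) [CommRing R] [Finite G] (g : G) :
    MonoidAlgebra R G →ₗ[R] R where
  toFun := partialAugmentation g
  map_add' a b := by
    classical
    have := Fintype.ofFinite G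
    simp only [partialAugmentation_eq_sum, ← Finset.sum_add_distrib]
    exact Finset.sum_congr rfl fun x _ ↦ by split_ifs <;> simp
  map_smul' r a := by
    classical
    have := Fintype.ofFinite G
    simp only [partialAugmentation_eq_sum, RingHom.id_apply, smul_eq_mul, Finset.mul_sum]
    exact Finset.sum_congr rfl fun x _ ↦ by split_ifs <;> simp

@[simp]
lemma partialAugmentationLinear_apply [Finite G] (g : G) (a : MonoidAlgebra R G) :
    partialAugmentationLinear R g a = partialAugmentation g a := rfl

open scoped Classical in
lemma partialAugmentation_single [Finite G] (g x : G) (r : R) :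
    partialAugmentation g (MonoidAlgebra.single x r) = if IsConj g x then r else 0 := by
  have := Fintype.ofFinite G
  rw [partialAugmentation_eq_sum, Finset.sum_eq_single x]
  · simp
  · intro y _ hy
    simp [hy.symm]
  · simp

lemma linearMap_eq_sum [Fintype G] (ψ : MonoidAlgebra R G →ₗ[R] R) (a : MonoidAlgebra R G) :
    ψ a = ∑ x, a.coeff x * ψ (MonoidAlgebra.single x 1) := by
  classical
  induction a using MonoidAlgebra.induction_linear with
  | zero => simp
  | add a b ha hb => simp [ha, hb, add_mul, Finset.sum_add_distrib]
  | single y r =>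
    rw [Finset.sum_eq_single y]
    · have : MonoidAlgebra.single y r = r • MonoidAlgebra.single y (1 : R) := by simp
      rw [this, map_smul]
      simp
    · intro x _ hx
      simp [hx.symm]
    · simp

lemma isConj_mul_comm (x y : G) : IsConj (x * y) (y * x) :=
  isConj_iff.2 ⟨y, by group⟩

lemma partialAugmentation_mul_comm [Finite G] (g : G) (a b : MonoidAlgebra R G) :
    partialAugmentation g (a * b) = partialAugmentation g (b * a) := by
  classical
  simp only [← partialAugmentationLinear_apply]
  induction a using MonoidAlgebra.induction_linear with
  | zero => simp
  | add a a' ha ha' => simp only [add_mul, mul_add, map_add, ha, ha']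
  | single x r =>
    induction b using MonoidAlgebra.induction_linear with
    | zero => simp
    | add b b' hb hb' => simp only [add_mul, mul_add, map_add, hb, hb']
    | single y s =>
      have : IsConj g (x * y) ↔ IsConj g (y * x) :=
        ⟨fun h ↦ h.trans (isConj_mul_comm x y), fun h ↦ h.trans (isConj_mul_comm y x)⟩
      simp only [MonoidAlgebra.single_mul_single, partialAugmentationLinear_apply,
        partialAugmentation_single, this, mul_comm r s]

/-- The pairing of `a` with a class function `f` as a combination of partial augmentations, summed
over representatives of the conjugacy classes. -/
lemma sum_coeff_mul_eq_sum_partialAugmentation [Fintype G] [Fintype (ConjClasses G)]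
    {rep : ConjClasses G → G} (hrep : ∀ c, ConjClasses.mk (rep c) = c)
    {f : G → R} (hf : ∀ x y, IsConj x y → f x = f y) (a : MonoidAlgebra R G) :
    ∑ x, a.coeff x * f x = ∑ c, partialAugmentation (rep c) a * f (rep c) := by
  classical
  rw [← Finset.sum_fiberwise (g := ConjClasses.mk)]
  refine Finset.sum_congr rfl fun c _ ↦ ?_
  rw [partialAugmentation_eq_sum, Finset.sum_mul, Finset.sum_filter]
  refine Finset.sum_congr rfl fun x _ ↦ ?_
  have hx : ConjClasses.mk x = c ↔ IsConj (rep c) x := by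
    rw [← ConjClasses.mk_eq_mk_iff_isConj, hrep, eq_comm]
  by_cases h : IsConj (rep c) x
  · rw [if_pos (hx.2 h), if_pos h, hf _ _ h]
  · rw [if_neg (mt hx.1 h), if_neg h, zero_mul]

lemma sum_coeff_mul_eq_of_partialAugmentation_eq [Fintype G] {f : G → R}
    (hf : ∀ x y, IsConj x y → f x = f y) {a b : MonoidAlgebra R G}
    (h : ∀ x, partialAugmentation x a = partialAugmentation x b) :
    ∑ x, a.coeff x * f x = ∑ x, b.coeff x * f x := by
  have := Fintype.ofFinite (ConjClasses G)
  have hrep := Function.surjInv_eq (ConjClasses.mk_surjective (α := G))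
  simp only [sum_coeff_mul_eq_sum_partialAugmentation hrep hf, h]

/-- A linear functional vanishing on additive commutators is determined by the partial
augmentations. -/
lemma linearMap_eq_of_partialAugmentation_eq [Finite G] (ψ : MonoidAlgebra R G →ₗ[R] R)
    (hψ : ∀ a b, ψ (a * b) = ψ (b * a)) {a b : MonoidAlgebra R G}
    (h : ∀ x, partialAugmentation x a = partialAugmentation x b) : ψ a = ψ b := by
  have := Fintype.ofFinite G
  rw [linearMap_eq_sum, linearMap_eq_sum]
  refine sum_coeff_mul_eq_of_partialAugmentation_eq (fun x y hxy ↦ ?_) h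
  obtain ⟨z, rfl⟩ := isConj_iff.1 hxy
  have := hψ (MonoidAlgebra.single (z * x) (1 : R)) (MonoidAlgebra.single z⁻¹ 1)
  simpa [MonoidAlgebra.single_mul_single] using this.symm

@[simp]
lemma augmentation_single (x : G) (r : R) : augmentation R G (MonoidAlgebra.single x r) = r := by
  simp [augmentation]

lemma augmentation_eq_sum_partialAugmentation [Finite G] [Fintype (ConjClasses G)]
    {rep : ConjClasses G → G} (hrep : ∀ c, ConjClasses.mk (rep c) = c) (a : MonoidAlgebra R G) :
    augmentation R G a = ∑ c : ConjClasses G, partialAugmentation (rep c) a := by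
  have := Fintype.ofFinite G
  have := sum_coeff_mul_eq_sum_partialAugmentation hrep (f := fun _ ↦ 1) (fun _ _ _ ↦ rfl) a
  rw [← AlgHom.coe_toLinearMap, linearMap_eq_sum]
  simpa using this

lemma partialAugmentation_mapRingHom [Finite G] {S : Type*} [CommRing S] (f : R →+* S) (g : G)
    (a : MonoidAlgebra R G) :
    partialAugmentation g (MonoidAlgebra.mapRingHom G f a) = f (partialAugmentation g a) := by
  classical
  have := Fintype.ofFinite G
  simp only [partialAugmentation_eq_sum, map_sum]
  exact Finset.sum_congr rfl fun x _ ↦ by split_ifs <;> simp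

lemma partialAugmentation_conj [Finite G] (g : G) (w : (MonoidAlgebra R G)ˣ)
    (a : MonoidAlgebra R G) :
    partialAugmentation g (w.val * a * w⁻¹.val) = partialAugmentation g a := by
  rw [partialAugmentation_mul_comm, Units.inv_mul_cancel_left]

end PartialAugmentation

end IntegralGroupRing
-- Prime powers in `ℤG` modulo `p`
open Equiv in
/-- If `σ ^ p = 1` then the sum of a `σ`-invariant function with values in characteristic `p`
is the sum over the fixed points of `σ`. -/
lemma sum_eq_sum_fixedPoints_of_pow_prime_eq_one {α : Type*} [Fintype α] [DecidableEq α]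
    {p : ℕ} [Fact p.Prime] (σ : Perm α) (hσ : σ ^ p = 1) (f : α → ZMod p)
    (hf : ∀ x, f (σ x) = f x) :
    ∑ x, f x = ∑ x with σ x = x, f x := by
  rw [← Finset.sum_filter_add_sum_filter_not Finset.univ (fun x ↦ σ x = x), add_eq_left,
    ← Finset.sum_fiberwise (g := f)]
  refine Finset.sum_eq_zero fun v _ ↦ ?_
  rw [Finset.sum_congr rfl (g := fun _ ↦ v) (fun x hx ↦ (Finset.mem_filter.1 hx).2),
    Finset.sum_const, nsmul_eq_mul]
  -- On each fibre of `f` the points moved by `σ` form orbits of length `p`, so their number is 0 in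
  -- `ZMod p`.
  let τ : Perm {x // f x = v} := σ.subtypePerm fun x ↦ by rw [hf]
  have hτ : τ ^ p ^ 1 = 1 := by
    ext x
    simp [τ, Perm.subtypePerm_pow, hσ]
  have h := Perm.card_compl_support_modEq hτ
  have h2 : τ.support.card = ({x ∈ {x | ¬σ x = x} | f x = v} : Finset α).card := by
    refine Finset.card_bij (fun x _ ↦ x.1) ?_ ?_ ?_
    · intro x hx
      simpa [τ, Subtype.ext_iff, x.2] using hx
    · exact fun x _ y _ h ↦ Subtype.ext h
    · intro x hx
      simp only [Finset.mem_filter, Finset.mem_univ, true_and] at hx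
      exact ⟨⟨x, hx.2⟩, by simpa [τ, Subtype.ext_iff] using hx.1, rfl⟩
  rw [← h2]
  have h3 := τ.support.card_add_card_compl
  have h4 : ((τ.support.card : ℕ) : ZMod p) = 0 := by
    have := (ZMod.natCast_eq_natCast_iff _ _ _).2 h
    rw [← h3, Nat.cast_add] at this
    exact add_eq_right.1 this.symm
  rw [h4, zero_mul]

namespace IntegralGroupRing

variable {G : Type*} [Group G]

/-- Rotation moves the first factor to the end, and `xy` is conjugate to `yx`. -/
lemma isConj_prod_ofFn_finRotate {n : ℕ} (r : Fin n → G) :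
    IsConj (List.ofFn (r ∘ finRotate n)).prod (List.ofFn r).prod := by
  cases n with
  | zero => simp
  | succ m =>
    have : r ∘ finRotate (m + 1) = Fin.snoc (Fin.tail r) (r 0) := by
      rw [Fin.snoc_eq_cons_rotate]
      ext i
      simp only [Function.comp]
      conv_lhs => rw [← Fin.cons_self_tail r]
    rw [this, List.ofFn_succ', List.ofFn_succ]
    simp only [Fin.snoc_castSucc, Fin.snoc_last, List.concat_eq_append, List.prod_append,
      List.prod_cons, List.prod_nil, mul_one, Fin.tail]
    exact isConj_mul_comm (List.ofFn fun i : Fin m ↦ r i.succ).prod (r 0)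

lemma apply_eq_of_comp_finRotate_eq {α : Type*} {m : ℕ} {r : Fin (m + 1) → α}
    (h : r ∘ finRotate (m + 1) = r) (i : Fin (m + 1)) : r i = r 0 := by
  induction i using Fin.induction with
  | zero => rfl
  | succ i ih =>
    rw [← ih]
    have := congrFun h i.castSucc
    simpa [finRotate_apply] using this

open scoped Classical in
/-- The partial augmentations of a `p`-th power, modulo `p`. -/
lemma partialAugmentation_pow_prime [Fintype G] {p : ℕ} [hp : Fact p.Prime]
    (x : G) (a : MonoidAlgebra ℤ G) :
    ((partialAugmentation x (a ^ p) : ℤ) : ZMod p) =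
      ∑ y, if IsConj x (y ^ p) then (a.coeff y : ZMod p) else 0 := by
  obtain ⟨m, rfl⟩ : ∃ m, p = m + 1 := ⟨p - 1, (Nat.succ_pred hp.out.ne_zero).symm⟩
  have ha : a = ∑ y, MonoidAlgebra.single y (a.coeff y) := by
    conv_lhs => rw [← MonoidAlgebra.sum_coeff_single a]
    exact Finsupp.sum_fintype _ _ (by simp)
  have hprod (r : Fin (m + 1) → G) :
      (List.ofFn fun i ↦ MonoidAlgebra.single (r i) (a.coeff (r i))).prod =
        MonoidAlgebra.single (List.ofFn r).prod (∏ i, a.coeff (r i)) := by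
    generalize m + 1 = k at r
    induction k with
    | zero => simp [MonoidAlgebra.one_def]
    | succ k ih =>
      simp only [List.ofFn_succ, List.prod_cons, Fin.prod_univ_succ]
      rw [ih fun i ↦ r i.succ, MonoidAlgebra.single_mul_single]
  have hpow : a ^ (m + 1) = ∑ r : Fin (m + 1) → G,
      MonoidAlgebra.single (List.ofFn r).prod (∏ i, a.coeff (r i)) := by
    conv_lhs => rw [← MultilinearMap.mkPiAlgebraFin_apply_const (R := ℤ) a, ha]
    rw [MultilinearMap.map_sum]
    simp only [MultilinearMap.mkPiAlgebraFin_apply, hprod]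
  let F : (Fin (m + 1) → G) → ZMod (m + 1) := fun r ↦
    if IsConj x (List.ofFn r).prod then ∏ i, (a.coeff (r i) : ZMod (m + 1)) else 0
  have hF : ((partialAugmentation x (a ^ (m + 1)) : ℤ) : ZMod (m + 1)) = ∑ r, F r := by
    rw [hpow, ← partialAugmentationLinear_apply, map_sum]
    push_cast
    refine Finset.sum_congr rfl fun r _ ↦ ?_
    simp only [partialAugmentationLinear_apply, partialAugmentation_single, F]
    split_ifs <;> simp
  let σ : Equiv.Perm (Fin (m + 1) → G) := (finRotate (m + 1)).symm.arrowCongr (Equiv.refl G)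
  have hσ (r) : σ r = r ∘ finRotate (m + 1) := rfl
  have hσpow (k : ℕ) (r) : (σ ^ k) r = r ∘ (finRotate (m + 1) ^ k : Equiv.Perm _) := by
    induction k generalizing r with
    | zero => rfl
    | succ k ih =>
      rw [pow_succ, Equiv.Perm.mul_apply, ih, hσ, pow_succ']
      rfl
  -- Only the rotation-invariant, hence constant, tuples survive modulo `p`; Fermat's little theorem
  -- turns their coefficient `a_y ^ p` into `a_y`.
  rw [hF, sum_eq_sum_fixedPoints_of_pow_prime_eq_one σ]
  · refine (Finset.sum_bij' (fun y _ ↦ fun _ ↦ y) (fun r _ ↦ r 0) ?_ ?_ ?_ ?_ ?_).symm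
    · intro y _
      simp [hσ, Function.comp_def]
    · simp
    · simp
    · intro r hr
      ext i
      exact (apply_eq_of_comp_finRotate_eq (by simpa [hσ] using hr) i).symm
    · intro y _
      simp only [F, List.ofFn_const, List.prod_replicate, Finset.prod_const, Finset.card_univ,
        Fintype.card_fin, ZMod.pow_card]
  · ext r : 1
    rw [hσpow]
    have : finRotate (m + 1) ^ (m + 1) = 1 := by
      have := Equiv.Perm.IsCycle.orderOf (isCycle_finRotate_of_le hp.out.two_le)
      rw [support_finRotate_of_le hp.out.two_le, Finset.card_univ, Fintype.card_fin] at this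
      exact orderOf_dvd_iff_pow_eq_one.1 this.dvd
    rw [this]
    rfl
  · intro r
    have h : IsConj x (List.ofFn (r ∘ finRotate (m + 1))).prod ↔ IsConj x (List.ofFn r).prod :=
      ⟨fun h ↦ h.trans (isConj_prod_ofFn_finRotate r),
        fun h ↦ h.trans (isConj_prod_ofFn_finRotate r).symm⟩
    simp only [F, hσ, h]
    congr 1
    exact Equiv.prod_comp (finRotate (m + 1)) fun i ↦ (a.coeff (r i) : ZMod (m + 1))

end IntegralGroupRing

/-! ### Characters determine modules in characteristic zero -/

namespace Representation

open Module

section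

variable {k H : Type*} [Field k] [Group H]
variable {M N P : Type*} [AddCommGroup M] [AddCommGroup N] [AddCommGroup P]
  [Module k M] [Module k N] [Module k P]
  [Module (MonoidAlgebra k H) M] [Module (MonoidAlgebra k H) N] [Module (MonoidAlgebra k H) P]
  [IsScalarTower k (MonoidAlgebra k H) M] [IsScalarTower k (MonoidAlgebra k H) N]
  [IsScalarTower k (MonoidAlgebra k H) P]

lemma ofModule'_apply (h : H) (m : M) :
    ofModule' (k := k) M h m = MonoidAlgebra.single h (1 : k) • m := rfl

lemma character_ofModule'_congr (e : M ≃ₗ[MonoidAlgebra k H] N) :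
    (ofModule' (k := k) (G := H) M).character = (ofModule' N).character := by
  ext h
  rw [character, character, ← LinearMap.trace_conj' _ (e.restrictScalars k)]
  congr 1
  ext n
  simp [ofModule'_apply, LinearEquiv.conj_apply]

lemma character_ofModule'_prod [FiniteDimensional k M] [FiniteDimensional k N] :
    (ofModule' (k := k) (G := H) (M × N)).character =
      (ofModule' M).character + (ofModule' N).character := by
  ext h
  simp only [character, Pi.add_apply]
  rw [← LinearMap.trace_prodMap']
  rfl

lemma character_ofModule'_of_isCompl [FiniteDimensional k M]
    {p q : Submodule (MonoidAlgebra k H) M} (hpq : IsCompl p q) :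
    (ofModule' (k := k) (G := H) M).character =
      (ofModule' p).character + (ofModule' q).character := by
  have : FiniteDimensional k p := inferInstanceAs (FiniteDimensional k (p.restrictScalars k))
  have : FiniteDimensional k q := inferInstanceAs (FiniteDimensional k (q.restrictScalars k))
  rw [← character_ofModule'_prod,
    character_ofModule'_congr (Submodule.prodEquivOfIsCompl p q hpq)]

/-- The pairing of characters computes the dimension of `Hom(M, N)`, so this equals the dimension of
`End(M)`, which contains the identity. -/
lemma exists_linearMap_ne_zero_of_character_eq [Finite H] [CharZero k] [FiniteDimensional k M]
    [FiniteDimensional k N] [Nontrivial M]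
    (h : (ofModule' (k := k) (G := H) M).character = (ofModule' N).character) :
    ∃ f : M →ₗ[MonoidAlgebra k H] N, f ≠ 0 := by
  have := Fintype.ofFinite H
  have : Invertible (Nat.card H : k) :=
    invertibleOfNonzero (Nat.cast_ne_zero.2 Nat.card_pos.ne')
  have h1 := card_inv_mul_sum_char_mul_char_eq_finrank
    (ofModule' (k := k) (G := H) M) (ofModule' N)
  rw [← h, card_inv_mul_sum_char_mul_char_eq_finrank, Nat.cast_inj] at h1
  have h2 : Nontrivial (IntertwiningMap (ofModule' (k := k) (G := H) M) (ofModule' M)) := by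
    obtain ⟨m, hm⟩ := exists_ne (0 : M)
    exact ⟨IntertwiningMap.id _, 0, fun h ↦ hm congr($h m)⟩
  have h3 : 0 < finrank k (IntertwiningMap (ofModule' (k := k) (G := H) M) (ofModule' M)) := by
    have : FiniteDimensional k
        (IntertwiningMap (ofModule' (k := k) (G := H) M) (ofModule' M)) :=
      .of_injective (IntertwiningMap.toLinearMapl _ _)
        (IntertwiningMap.toLinearMap_injective _ _)
    exact finrank_pos
  rw [h1] at h3
  have : Nontrivial (IntertwiningMap (ofModule' (k := k) (G := H) M) (ofModule' N)) :=
    nontrivial_of_finrank_pos h3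
  obtain ⟨f, hf⟩ :=
    exists_ne (0 : IntertwiningMap (ofModule' (k := k) (G := H) M) (ofModule' N))
  refine ⟨MonoidAlgebra.equivariantOfLinearOfComm f.toLinearMap fun g v ↦ f.isIntertwining _ _ g v,
    fun h0 ↦ hf ?_⟩
  ext m
  exact congr($h0 m)

/-- Finite-dimensional modules over the group algebra of a finite group in characteristic zero
are determined by their characters. -/
theorem nonempty_linearEquiv_of_character_eq [Finite H] [CharZero k] [FiniteDimensional k M]
    [FiniteDimensional k N]
    (h : (ofModule' (k := k) (G := H) M).character = (ofModule' N).character) :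
    Nonempty (M ≃ₗ[MonoidAlgebra k H] N) := by
  induction hn : finrank k M using Nat.strong_induction_on generalizing M N with
  | _ n ih =>
  have hfr : finrank k M = finrank k N := by
    have := congrFun h 1
    rwa [char_one, char_one, Nat.cast_inj] at this
  cases subsingleton_or_nontrivial M with
  | inl hM =>
    have : Subsingleton N := finrank_zero_iff.1 (hfr ▸ finrank_zero_of_subsingleton)
    exact ⟨0⟩
  | inr hM =>
    obtain ⟨f, hf⟩ := exists_linearMap_ne_zero_of_character_eq h
    have : NeZero (Nat.card H : k) := ⟨Nat.cast_ne_zero.2 Nat.card_pos.ne'⟩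
    -- By Maschke, `M = ker f ⊕ C` and `N = range f ⊕ D` with `C ≃ range f`. Cancelling characters
    -- leaves `ker f` and `D`, to which induction applies.
    obtain ⟨C, hC⟩ := MonoidAlgebra.Submodule.exists_isCompl (LinearMap.ker f)
    obtain ⟨D, hD⟩ := MonoidAlgebra.Submodule.exists_isCompl (LinearMap.range f)
    have e : C ≃ₗ[MonoidAlgebra k H] LinearMap.range f :=
      (Submodule.quotientEquivOfIsCompl _ C hC).symm.trans f.quotKerEquivRange
    rw [character_ofModule'_of_isCompl hC, character_ofModule'_of_isCompl hD,
      character_ofModule'_congr e, add_comm, add_left_cancel_iff] at h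
    have : FiniteDimensional k (LinearMap.ker f) :=
      inferInstanceAs (FiniteDimensional k ((LinearMap.ker f).restrictScalars k))
    have : FiniteDimensional k D :=
      inferInstanceAs (FiniteDimensional k (D.restrictScalars k))
    have hlt : finrank k (LinearMap.ker f) < n := by
      rw [← hn]
      refine Submodule.finrank_lt (s := (LinearMap.ker f).restrictScalars k) ?_
      exact fun h0 ↦ hf (LinearMap.ker_eq_top.1 ((Submodule.restrictScalars_eq_top_iff k _ _).1 h0))
    obtain ⟨e'⟩ := ih _ hlt h rfl
    exact ⟨(Submodule.prodEquivOfIsCompl _ _ hC).symm.trans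
      ((e'.prodCongr e).trans ((LinearEquiv.prodComm _ _ _).trans
        (Submodule.prodEquivOfIsCompl _ _ hD)))⟩

end

lemma single_smul_asModuleEquiv_symm {k H V : Type*} [Field k] [Group H] [AddCommGroup V]
    [Module k V] (ρ : Representation k H V) (h : H) (v : V) :
    MonoidAlgebra.single h (1 : k) • ρ.asModuleEquiv.symm v = ρ.asModuleEquiv.symm (ρ h v) :=
  (ρ.asModuleEquiv_symm_map_rho h v).symm

lemma character_ofModule'_asModule {k H V : Type*} [Field k] [Group H] [AddCommGroup V]
    [Module k V] (ρ : Representation k H V) :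
    (ofModule' (k := k) (G := H) ρ.asModule).character = ρ.character := by
  ext h
  rw [character, character, ← LinearMap.trace_conj' (ρ h) ρ.asModuleEquiv.symm]
  congr 1
  ext u
  obtain ⟨v, rfl⟩ := ρ.asModuleEquiv.symm.surjective u
  rw [ofModule'_apply, single_smul_asModuleEquiv_symm]
  simp only [LinearEquiv.conj_apply_apply, LinearEquiv.symm_symm, LinearEquiv.apply_symm_apply]

/-- Finite-dimensional representations of a finite group in characteristic zero are determined
by their characters. -/
theorem nonempty_equiv_of_character_eq {k H V W : Type*} [Field k] [CharZero k] [Group H] [Finite H]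
    [AddCommGroup V] [Module k V] [FiniteDimensional k V]
    [AddCommGroup W] [Module k W] [FiniteDimensional k W]
    {ρ : Representation k H V} {σ : Representation k H W} (h : ρ.character = σ.character) :
    Nonempty (ρ.Equiv σ) := by
  rw [← character_ofModule'_asModule ρ, ← character_ofModule'_asModule σ] at h
  obtain ⟨e⟩ := nonempty_linearEquiv_of_character_eq h
  refine ⟨Equiv.mk (ρ.asModuleEquiv.symm ≪≫ₗ e.restrictScalars k ≪≫ₗ σ.asModuleEquiv)
    fun h ↦ ?_⟩
  ext v
  simp only [LinearMap.comp_apply, LinearEquiv.coe_coe, LinearEquiv.trans_apply,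
    LinearEquiv.restrictScalars_apply]
  rw [← single_smul_asModuleEquiv_symm, map_smul]
  apply σ.asModuleEquiv.symm.injective
  rw [← single_smul_asModuleEquiv_symm, LinearEquiv.symm_apply_apply,
    LinearEquiv.symm_apply_apply]

end Representation

/-! ### The two-sided action on `kG` and conjugacy of units -/

namespace IntegralGroupRing

variable {G : Type*} [Group G]

/-- The representation of `K × G` on `kG`, where `K` acts through units by left multiplication
and `G` by right multiplication. -/
noncomputable def bimoduleRepresentation {k K : Type*} [Field k] [Group K]
    (φ : K →* (MonoidAlgebra k G)ˣ) : Representation k (K × G) (MonoidAlgebra k G) where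
  toFun h := LinearMap.mulLeft k (φ h.1).val * LinearMap.mulRight k (MonoidAlgebra.single h.2⁻¹ 1)
  map_one' := by
    ext; simp [← MonoidAlgebra.one_def]
  map_mul' a b := by
    refine LinearMap.ext fun m ↦ ?_
    simp [mul_assoc]

lemma bimoduleRepresentation_apply {k K : Type*} [Field k] [Group K]
    (φ : K →* (MonoidAlgebra k G)ˣ) (h : K × G) (m : MonoidAlgebra k G) :
    bimoduleRepresentation φ h m = (φ h.1).val * (m * MonoidAlgebra.single h.2⁻¹ 1) := rfl

/-- For fixed `g`, the trace of `m ↦ x * m * g⁻¹` is linear in `x` and kills commutators, because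
left and right multiplications commute. -/
lemma character_bimoduleRepresentation_eq [Finite G] {k K : Type*} [Field k] [Group K]
    (φ ψ : K →* (MonoidAlgebra k G)ˣ)
    (h : ∀ a x, partialAugmentation x (φ a).val = partialAugmentation x (ψ a).val) :
    (bimoduleRepresentation φ).character = (bimoduleRepresentation ψ).character := by
  ext ⟨a, g⟩
  let R := LinearMap.mulRight k (MonoidAlgebra.single g⁻¹ (1 : k))
  let T : MonoidAlgebra k G →ₗ[k] k :=
    LinearMap.trace k _ ∘ₗ LinearMap.mulRight k R ∘ₗ LinearMap.mul k (MonoidAlgebra k G)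
  refine linearMap_eq_of_partialAugmentation_eq T (fun x y ↦ ?_) (h a)
  have hT (x) : T x = LinearMap.trace k _ (LinearMap.mulLeft k x * R) := rfl
  have hc (x) : LinearMap.mulLeft k x * R = R * LinearMap.mulLeft k x :=
    LinearMap.ext fun m ↦ by simp [R, mul_assoc]
  have hm (x y : MonoidAlgebra k G) :
      LinearMap.mulLeft k (x * y) = LinearMap.mulLeft k x * LinearMap.mulLeft k y :=
    LinearMap.ext fun m ↦ by simp
  rw [hT, hT, hm, hm, mul_assoc, LinearMap.trace_mul_comm, mul_assoc, mul_assoc, ← hc]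

/-- Commuting with the action of `G` makes `e` right `kG`-linear. -/
lemma equiv_bimoduleRepresentation_apply [Finite G] {k K : Type*} [Field k] [Group K]
    {φ ψ : K →* (MonoidAlgebra k G)ˣ}
    (e : (bimoduleRepresentation φ).Equiv (bimoduleRepresentation ψ)) (m : MonoidAlgebra k G) :
    e m = e 1 * m := by
  induction m using MonoidAlgebra.induction_linear with
  | zero => simp
  | add a b ha hb => rw [map_add, ha, hb, mul_add]
  | single g r =>
    have := e.isIntertwining _ _ (1, g⁻¹) 1
    simp only [bimoduleRepresentation_apply, map_one, Units.val_one, one_mul, inv_inv,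
      Representation.Equiv.coe_toIntertwiningMap] at this
    have hr : MonoidAlgebra.single g r = r • MonoidAlgebra.single g (1 : k) := by simp
    rw [hr, map_smul, this, mul_smul_comm]

/-- Two units of finite order of `kG`, with `k` of characteristic zero, are conjugate if the
partial augmentations of their powers agree. -/
theorem isConj_of_partialAugmentation_pow_eq [Finite G] {k : Type*} [Field k] [CharZero k]
    {u v : (MonoidAlgebra k G)ˣ} (hu : IsOfFinOrder u) (hv : IsOfFinOrder v)
    (h : ∀ (j : ℕ) x, partialAugmentation x (u ^ j).val = partialAugmentation x (v ^ j).val) :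
    ∃ w : (MonoidAlgebra k G)ˣ, w * u * w⁻¹ = v := by
  have huv : IsOfFinOrder (u, v) := hu.prod_mk hv
  -- One finite group acts through `u` and through `v` by the two projections, even if their orders
  -- were to differ.
  let K := Subgroup.zpowers (u, v)
  have : Finite K := Set.finite_coe_iff.2 huv.finite_zpowers
  let φ : K →* (MonoidAlgebra k G)ˣ := (MonoidHom.fst _ _).comp K.subtype
  let ψ : K →* (MonoidAlgebra k G)ˣ := (MonoidHom.snd _ _).comp K.subtype
  obtain ⟨e⟩ := Representation.nonempty_equiv_of_character_eq
    (character_bimoduleRepresentation_eq φ ψ fun ⟨a, ha⟩ x ↦ by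
      obtain ⟨j, rfl⟩ := (huv.mem_powers_iff_mem_zpowers).2 ha
      exact h j x)
  have h1 : e.symm 1 * e 1 = 1 := by
    rw [← equiv_bimoduleRepresentation_apply, e.symm_apply_apply]
  have h2 : e 1 * e.symm 1 = 1 := by
    rw [← equiv_bimoduleRepresentation_apply, e.apply_symm_apply]
  refine ⟨⟨e 1, e.symm 1, h2, h1⟩, ?_⟩
  rw [mul_inv_eq_iff_eq_mul]
  ext1
  have := e.isIntertwining _ _ (⟨(u, v), Subgroup.mem_zpowers _⟩, 1) 1
  simp only [bimoduleRepresentation_apply, inv_one, ← MonoidAlgebra.one_def, mul_one,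
    Representation.Equiv.coe_toIntertwiningMap] at this
  rw [equiv_bimoduleRepresentation_apply] at this
  exact this

end IntegralGroupRing

/-! ### Partial augmentations of the powers of a torsion unit -/

namespace IntegralGroupRing

variable {G : Type*} [Group G]

lemma augmentation_eq_of_partialAugmentation_eq {R : Type*} [CommRing R] [Finite G]
    {a b : MonoidAlgebra R G} (h : ∀ x, partialAugmentation x a = partialAugmentation x b) :
    augmentation R G a = augmentation R G b :=
  linearMap_eq_of_partialAugmentation_eq (augmentation R G).toLinearMap
    (fun a b ↦ by simp [mul_comm]) h

lemma augmentation_pow_eq_one {u : (MonoidAlgebra ℤ G)ˣ} (hu : u ∈ normalizedUnits ℤ G) (j : ℕ) :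
    augmentation ℤ G (u ^ j).val = 1 := by
  have := (normalizedUnits ℤ G).pow_mem hu j
  exact congrArg Units.val (MonoidHom.mem_ker.1 this)

lemma partialAugmentation_eq_of_forall_not_isConj [Finite G] {a : MonoidAlgebra ℤ G}
    (ha : augmentation ℤ G a = 1) {g : G} (h : ∀ x, ¬IsConj g x → partialAugmentation x a = 0)
    (x : G) : partialAugmentation x a = partialAugmentation x (MonoidAlgebra.single g 1) := by
  classical
  have key (x : G) : partialAugmentation x a =
      partialAugmentation x (MonoidAlgebra.single g (partialAugmentation g a)) := by
    rw [partialAugmentation_single]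
    split_ifs with hx
    · exact partialAugmentation_congr hx a
    · exact h x fun h ↦ hx h.symm
  have := augmentation_eq_of_partialAugmentation_eq key
  rw [ha, augmentation_single] at this
  rw [key x, ← this]

lemma exists_forall_not_isConj_partialAugmentation_eq_zero [Finite G] {a : MonoidAlgebra ℤ G}
    (ha : augmentation ℤ G a = 1) (h : ∀ x, 0 ≤ partialAugmentation x a) :
    ∃ g, ∀ x, ¬IsConj g x → partialAugmentation x a = 0 := by
  classical
  have := Fintype.ofFinite (ConjClasses G)
  have hrep := Function.surjInv_eq (ConjClasses.mk_surjective (α := G))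
  set rep := Function.surjInv (ConjClasses.mk_surjective (α := G))
  rw [augmentation_eq_sum_partialAugmentation hrep] at ha
  obtain ⟨c, -, hc⟩ := Finset.exists_ne_zero_of_sum_ne_zero (ha.trans_ne one_ne_zero)
  have hc1 : 1 ≤ partialAugmentation (rep c) a := (h _).lt_of_ne' hc
  refine ⟨rep c, fun x hx ↦ ?_⟩
  have hx' : IsConj x (rep (ConjClasses.mk x)) :=
    ConjClasses.mk_eq_mk_iff_isConj.1 (hrep _).symm
  rw [partialAugmentation_congr hx']
  rw [← Finset.add_sum_erase _ _ (Finset.mem_univ c)] at ha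
  have hmem : ConjClasses.mk x ∈ Finset.univ.erase c := by
    refine Finset.mem_erase.2 ⟨fun h ↦ hx ?_, Finset.mem_univ _⟩
    rw [← ConjClasses.mk_eq_mk_iff_isConj, hrep, h]
  have hle := Finset.single_le_sum (f := fun c ↦ partialAugmentation (rep c) a)
    (fun c _ ↦ h _) hmem
  have := h (rep (ConjClasses.mk x))
  omega

/-- Modulo `p`, the partial augmentations of `a ^ p` pair `a` with the class function `y ↦ [x ~ y ^
p]`, so they depend only on those of `a`. -/
lemma partialAugmentation_pow_prime_of_eq_single [Finite G] {p : ℕ} (hp : p.Prime)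
    {a : MonoidAlgebra ℤ G} {g : G}
    (h : ∀ x, partialAugmentation x a = partialAugmentation x (MonoidAlgebra.single g 1)) (x : G) :
    partialAugmentation x (a ^ p) ≡
      partialAugmentation x (MonoidAlgebra.single (g ^ p) 1) [ZMOD p] := by
  classical
  have := Fintype.ofFinite G
  have := Fact.mk hp
  have hb : MonoidAlgebra.single (g ^ p) (1 : ℤ) = MonoidAlgebra.single g 1 ^ p := by
    rw [MonoidAlgebra.single_pow, one_pow]
  rw [← ZMod.intCast_eq_intCast_iff, hb, partialAugmentation_pow_prime,
    partialAugmentation_pow_prime]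
  have hf (y z : G) (hyz : IsConj y z) :
      (if IsConj x (y ^ p) then (1 : ℤ) else 0) = if IsConj x (z ^ p) then 1 else 0 := by
    have := hyz.pow p
    exact if_congr ⟨fun h ↦ h.trans this, fun h ↦ h.trans this.symm⟩ rfl rfl
  have := congrArg (Int.cast : ℤ → ZMod p) (sum_coeff_mul_eq_of_partialAugmentation_eq hf h)
  simpa only [mul_ite, mul_one, mul_zero, Int.cast_sum, Int.cast_ite, Int.cast_zero] using this

lemma partialAugmentation_pow_eq_single_of_dvd [Finite G] {u : (MonoidAlgebra ℤ G)ˣ} {n : ℕ}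
    (hn : 0 < n)
    (h : ∀ d, d ∣ n → ∃ g, ∀ x, partialAugmentation x (u ^ d).val =
      partialAugmentation x (MonoidAlgebra.single g 1)) :
    ∃ g : G, ∀ d, d ∣ n → ∀ x, partialAugmentation x (u ^ d).val =
      partialAugmentation x (MonoidAlgebra.single (g ^ d) 1) := by
  classical
  obtain ⟨g, hg⟩ := h 1 (one_dvd n)
  refine ⟨g, fun d ↦ ?_⟩
  induction d using induction_on_primes with
  | zero => exact fun h0 ↦ absurd (Nat.eq_zero_of_zero_dvd h0) hn.ne'
  | one => simpa using hg
  | prime_mul p d hp ih =>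
    intro hd x
    obtain ⟨g', hg'⟩ := h _ hd
    -- Evaluated at `g ^ (p * d)`: were this not conjugate to `g'`, the congruence would read 0 ≡ 1
    -- modulo `p`.
    have h1 := partialAugmentation_pow_prime_of_eq_single hp (ih (dvd_of_mul_left_dvd hd))
      ((g ^ d) ^ p)
    rw [← pow_mul, ← Units.val_pow_eq_pow_val, ← pow_mul, mul_comm d p, hg',
      partialAugmentation_single, partialAugmentation_single, if_pos (IsConj.refl _)] at h1
    have hc : IsConj (g ^ (p * d)) g' := by
      by_contra hc
      rw [if_neg hc] at h1
      have := (Int.modEq_zero_iff_dvd.1 h1.symm)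
      exact hp.one_lt.ne' (by exact_mod_cast Int.eq_one_of_dvd_one (by positivity) this)
    rw [hg', partialAugmentation_single, partialAugmentation_single]
    exact if_congr ⟨fun h ↦ h.trans hc.symm, fun h ↦ h.trans hc⟩ rfl rfl

lemma partialAugmentation_pow_eq_single [Finite G] {u : (MonoidAlgebra ℤ G)ˣ} {n : ℕ}
    (hn : 0 < n) (hu : u ^ n = 1) {g : G} (hgn : g ^ n = 1)
    (h : ∀ d, d ∣ n → ∀ x, partialAugmentation x (u ^ d).val =
      partialAugmentation x (MonoidAlgebra.single (g ^ d) 1)) (j : ℕ) (x : G) :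
    partialAugmentation x (u ^ j).val =
      partialAugmentation x (MonoidAlgebra.single (g ^ j) 1) := by
  classical
  obtain ⟨d, j', n', hd, hcop, rfl, rfl⟩ := Nat.exists_coprime' (m := j) (n := n)
    (Nat.gcd_pos_of_pos_right _ hn)
  -- Dirichlet: a prime `p ≡ j'` modulo `n'` gives `u ^ (j' * d) = (u ^ d) ^ p`, and likewise for
  -- `g`. Since `p` exceeds the difference of the two values, their congruence is an equality.
  obtain ⟨p, hpgt, hp, hmod⟩ := Nat.forall_exists_prime_gt_and_modEq
    (partialAugmentation x (u ^ (j' * d)).val -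
      partialAugmentation x (MonoidAlgebra.single (g ^ (j' * d)) 1)).natAbs
    (left_ne_zero_of_mul hn.ne') hcop
  have hmod' : p * d ≡ j' * d [MOD n' * d] := hmod.mul_right' d
  have h1 := partialAugmentation_pow_prime_of_eq_single hp (h d (dvd_mul_left _ _)) x
  rw [← Units.val_pow_eq_pow_val, ← pow_mul, ← pow_mul, mul_comm d p,
    pow_eq_pow_of_modEq hmod' hu, pow_eq_pow_of_modEq hmod' hgn] at h1
  have := Int.eq_zero_of_abs_lt_dvd h1.symm.dvd (by rw [Int.abs_eq_natAbs]; exact_mod_cast hpgt)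
  exact sub_eq_zero.1 this

lemma pow_eq_one_of_partialAugmentation_one [Finite G] {g : G}
    (h : partialAugmentation 1 (1 : MonoidAlgebra ℤ G) =
      partialAugmentation 1 (MonoidAlgebra.single g 1)) : g = 1 := by
  classical
  rw [MonoidAlgebra.one_def, partialAugmentation_single, partialAugmentation_single,
    if_pos (IsConj.refl _)] at h
  by_contra hg
  rw [if_neg fun h ↦ hg (isConj_one_right.1 h)] at h
  exact one_ne_zero h

lemma toRationalUnits_pow_groupUnit (g : G) (j : ℕ) :
    (toRationalUnits G (groupUnit ℤ g) ^ j).val = MonoidAlgebra.single (g ^ j) (1 : ℚ) := by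
  simp [toRationalUnits, groupUnit]

lemma partialAugmentation_toRationalUnits_pow [Finite G] (u : (MonoidAlgebra ℤ G)ˣ) (j : ℕ)
    (x : G) : partialAugmentation x (toRationalUnits G u ^ j).val =
      ((partialAugmentation x (u ^ j).val : ℤ) : ℚ) := by
  rw [← map_pow]
  exact partialAugmentation_mapRingHom (Int.castRingHom ℚ) x _

lemma partialAugmentation_pow_of_rationallyConjugate [Finite G] {u : (MonoidAlgebra ℤ G)ˣ} {g : G}
    (h : RationallyConjugate u (groupUnit ℤ g)) (j : ℕ) (x : G) :
    partialAugmentation x (u ^ j).val =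
      partialAugmentation x (MonoidAlgebra.single (g ^ j) 1) := by
  obtain ⟨w, hw⟩ := h
  have h1 : ((groupUnit ℤ g) ^ j).val = MonoidAlgebra.single (g ^ j) 1 := by simp [groupUnit]
  rw [← Int.cast_inj (α := ℚ), ← h1, ← partialAugmentation_toRationalUnits_pow,
    ← partialAugmentation_toRationalUnits_pow, ← hw, conj_pow, Units.val_mul, Units.val_mul,
    partialAugmentation_conj]

end IntegralGroupRing
theorem mainTheorem7 {G : Type*} [Group G] [Finite G]
    (u : (MonoidAlgebra ℤ G)ˣ) (hu : u ∈ IntegralGroupRing.normalizedUnits ℤ G)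
    (n : ℕ) (hn : 0 < n) (hun : orderOf u = n) :
    List.TFAE
      [∃ g : G, IntegralGroupRing.RationallyConjugate u (IntegralGroupRing.groupUnit ℤ g),
       ∀ d : ℕ, d ∣ n → ∃ g_d : G, ∀ g : G, g ∉ conjugatesOf g_d →
         IntegralGroupRing.partialAugmentation g ((u ^ d : (MonoidAlgebra ℤ G)ˣ) :
           MonoidAlgebra ℤ G) = 0,
       ∀ d : ℕ, d ∣ n → ∀ g : G,
         0 ≤ IntegralGroupRing.partialAugmentation g ((u ^ d : (MonoidAlgebra ℤ G)ˣ) :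
           MonoidAlgebra ℤ G)] := by
  classical
  open IntegralGroupRing in
  have hun' : u ^ n = 1 := hun ▸ pow_orderOf_eq_one u
  tfae_have 1 → 3 := by
    rintro ⟨g, hg⟩ d - x
    rw [partialAugmentation_pow_of_rationallyConjugate hg, partialAugmentation_single]
    split_ifs <;> simp
  tfae_have 3 → 2 := fun h d hd ↦
    exists_forall_not_isConj_partialAugmentation_eq_zero (augmentation_pow_eq_one hu d) (h d hd)
  tfae_have 2 → 1 := by
    intro h
    obtain ⟨g, hg⟩ := partialAugmentation_pow_eq_single_of_dvd hn fun d hd ↦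
      (h d hd).imp fun g hg ↦
        partialAugmentation_eq_of_forall_not_isConj (augmentation_pow_eq_one hu d) hg
    -- The case `d = n`: `g ^ n` has the partial augmentation of `u ^ n = 1` at the identity, whose
    -- class is a singleton.
    have hgn : g ^ n = 1 := pow_eq_one_of_partialAugmentation_one (by
      simpa [hun'] using hg n dvd_rfl 1)
    refine ⟨g, isConj_of_partialAugmentation_pow_eq ?_ ?_ fun j x ↦ ?_⟩
    · exact (toRationalUnits G).isOfFinOrder (isOfFinOrder_iff_pow_eq_one.2 ⟨n, hn, hun'⟩)
    · refine isOfFinOrder_iff_pow_eq_one.2 ⟨n, hn, ?_⟩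
      ext1
      rw [toRationalUnits_pow_groupUnit, hgn]
      rfl
    · rw [partialAugmentation_toRationalUnits_pow, toRationalUnits_pow_groupUnit,
        partialAugmentation_pow_eq_single hn hun' hgn hg, partialAugmentation_single,
        partialAugmentation_single]
      split_ifs <;> simp
  tfae_finish
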